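/- Let $\mathbb M=\mathbb N\times[0,1]$, let $\mathbb M^*=\beta\mathbb M\setminus\mathbb M$ and $\mathbb N^*=\beta\mathbb N\setminus\mathbb N$ (the free ultrafilters on $\mathbb N$). A \emph{standard sequence} is a locally finite sequence $\{[a_m,b_m]:m\in\mathbb N\}$ of pairwise disjoint, non-degenerate closed intervals of $\mathbb M$ (each contained in one fibre $\{n\}\times[0,1]$). For $u\in\mathbb N^*$ let $$[a_m,b_m]_u=\bigcap_{U\in u}\mathrm{cl}_{\beta\mathbb M}\Big(\bigcup_{m\in U}[a_m,b_m]\Big)\subseteq\mathbb M^* .$$ A \emph{selector sequence} for $\{[a_m,b_m]\}$ is a sequence of points $x_m$ of $\mathbb M$ with $a_m<x_m<b_m$ for all $m$; put $x_u=u\text{-}\lim x_m\in\mathbb M^*$ and $\{x_m:m\in\mathbb N\}^*=\mathrm{cl}_{\beta\mathbb M}\{x_m:m\in\mathbb N\}\setminus\mathbb M$. The points $x_u$, for $\{x_m\}$ a selector sequence, are the \emph{standard cut-points} of $[a_m,b_m]_u$; they are linearly ordered as in the ultraproduct: $x_u\le y_u$ if and only if $\{m:x_m\le y_m\}\in u$.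 A \emph{subinterval} of $[a_m,b_m]_u$ is the closure of a non-empty interval (order-convex set) of standard cut-points, and, for a homeomorphism $\Psi$ of $\mathbb M^*$, a subinterval of $\Psi([a_m,b_m]_u)$ is the image under $\Psi$ of a subinterval of $[a_m,b_m]_u$. \textbf{Theorem.} Let $\Psi:\mathbb M^*\to\mathbb M^*$ be a homeomorphism, let $\{[a_m,b_m]:m\in\mathbb N\}$ be a standard sequence, and let $\{x_m:m\in\mathbb N\}$ be a selector sequence for it. Then there are a standard sequence $\{[c_j,d_j]:j\in\mathbb N\}$ and a homeomorphism $h:\mathbb N^*\to\mathbb N^*$ such that 1. $\Psi(x_u)\in[c_j,d_j]_{h(u)}$ for every $u\in\mathbb N^*$; 2. $[c_j,d_j]_{h(u)}$ is a subinterval of $\Psi([a_m,b_m]_u)$ for every $u\in\mathbb N^*$; 3. $\Psi(\{x_m:m\in\mathbb N\}^*)=\{\Psi(x_u):u\in\mathbb N^*\}$, and the mapping $\Psi(x_u)\mapsto h(u)$ is a (well-defined) homeomorphism from this subspace of $\mathbb M^*$ onto $\mathbb N^*$. -/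

import Mathlib

open Set Filter Topology

/-- The space `𝕄 = ℕ × [0,1]`, with the product topology. -/
abbrev MM : Type := ℕ × unitInterval

/-- The remainder `𝕄* = β𝕄 \ 𝕄`. -/
abbrev MMStar : Type :=
  {p : StoneCech MM // p ∉ range (stoneCechUnit : MM → StoneCech MM)}

/-- The remainder `ℕ* = βℕ \ ℕ`, where `βℕ` is the space of ultrafilters on `ℕ`. -/
abbrev NNStar : Type :=
  {u : Ultrafilter ℕ // u ∉ range (pure : ℕ → Ultrafilter ℕ)}

/-- For a sequence of subsets `A m` of a topological space, the set of `u`-limits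
`⋂_{a ∈ u} cl (⋃_{m ∈ a} A m)`. -/
def uLimSet {X : Type*} [TopologicalSpace X] (u : Ultrafilter ℕ) (A : ℕ → Set X) : Set X :=
  ⋂ a ∈ u, closure (⋃ m ∈ a, A m)

/-- For `D ⊆ 𝕄`, the set `D* = cl_{β𝕄}(D) \ 𝕄`, as a subset of `𝕄*`. -/
def starSet (D : Set MM) : Set MMStar :=
  {p | p.1 ∈ closure (stoneCechUnit '' D)}

/-- The closed interval `{n} × [a, b]` of `𝕄`. -/
def interval (n : ℕ) (a b : unitInterval) : Set MM := {n} ×ˢ Icc a b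

/-- A standard sequence: a locally finite sequence of pairwise disjoint non-trivial
closed intervals `[a_m, b_m]` of `𝕄`; the `m`-th one lies in the fibre `{n_m} × [0,1]`
and is `{n_m} × [a_m, b_m]`. Different members may lie in the same fibre. -/
structure StandardSequence where
  /-- the index `n_m` of the fibre containing the `m`-th interval -/
  fibre : ℕ → ℕ
  /-- the left end-points `a_m` -/
  lo : ℕ → unitInterval
  /-- the right end-points `b_m` -/
  hi : ℕ → unitInterval
  lo_lt_hi : ∀ m, lo m < hi m
  pairwise_disjoint : Pairwise fun i j =>
    Disjoint (interval (fibre i) (lo i) (hi i)) (interval (fibre j) (lo j) (hi j))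
  locallyFinite : LocallyFinite fun m => interval (fibre m) (lo m) (hi m)

namespace StandardSequence

/-- The `m`-th interval `[a_m, b_m]`. -/
def Ivl (A : StandardSequence) (m : ℕ) : Set MM := interval (A.fibre m) (A.lo m) (A.hi m)

/-- The continuum `[a_m, b_m]_u = u-lim [a_m, b_m]` (computed in `β𝕄`), as a subset
of `𝕄*`. -/
def continuumAt (A : StandardSequence) (u : NNStar) : Set MMStar :=
  {p | p.1 ∈ uLimSet u.1 fun m => stoneCechUnit '' A.Ivl m}

/-- A selector sequence: points `x_m` with `a_m < x_m < b_m`. -/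
structure Selector (A : StandardSequence) where
  /-- the second coordinate of the `m`-th selected point -/
  coord : ℕ → unitInterval
  lo_lt : ∀ m, A.lo m < coord m
  lt_hi : ∀ m, coord m < A.hi m

/-- The point `x_m` of `𝕄`. -/
def Selector.pt {A : StandardSequence} (x : A.Selector) (m : ℕ) : MM :=
  (A.fibre m, x.coord m)

theorem Selector.pt_mem {A : StandardSequence} (x : A.Selector) (m : ℕ) :
    x.pt m ∈ A.Ivl m :=
  ⟨rfl, (x.lo_lt m).le, (x.lt_hi m).le⟩

/-- The limit along a free ultrafilter of a selector sequence is not in `𝕄`. -/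
theorem Selector.lim_notMem {A : StandardSequence} (x : A.Selector) (u : NNStar) :
    (u.1.map fun m => stoneCechUnit (x.pt m)).lim ∉
      range (stoneCechUnit : MM → StoneCech MM) := by
  rintro ⟨p, hp⟩
  obtain ⟨V, hV, hfin⟩ := A.locallyFinite p
  have hle := Ultrafilter.le_nhds_lim (u.1.map fun m => stoneCechUnit (x.pt m))
  rw [← hp] at hle
  rw [(isInducing_stoneCechUnit (X := MM)).nhds_eq_comap] at hV
  obtain ⟨W, hW, hWV⟩ := hV
  have h1 : {m | stoneCechUnit (x.pt m) ∈ W} ∈ u.1 := hle hW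
  have h2 : {m | stoneCechUnit (x.pt m) ∈ W}.Finite :=
    hfin.subset fun m hm => ⟨x.pt m, x.pt_mem m, hWV hm⟩
  obtain ⟨n, -, hn⟩ := Ultrafilter.eq_pure_of_finite_mem h2 h1
  exact u.2 ⟨n, hn.symm⟩

/-- The point `x_u = u-lim x_m` of `𝕄*`. -/
noncomputable def Selector.limPt {A : StandardSequence} (x : A.Selector) (u : NNStar) : MMStar :=
  ⟨(u.1.map fun m => stoneCechUnit (x.pt m)).lim, x.lim_notMem u⟩

/-- `K` is a subinterval of `[a_m, b_m]_u`: the closure of a (non-empty) interval `S` of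
the linearly ordered set of standard cut-points `x_u`, `x` a selector sequence. The order
is that of the ultraproduct: `x_u ≤ y_u` if and only if `{m | x_m ≤ y_m} ∈ u`. -/
def IsSubinterval (A : StandardSequence) (u : NNStar) (K : Set MMStar) : Prop :=
  ∃ S : Set MMStar, S ⊆ range (fun x : A.Selector => x.limPt u) ∧ S.Nonempty ∧
    (∀ x y z : A.Selector, x.limPt u ∈ S → y.limPt u ∈ S →
      {m | x.coord m ≤ z.coord m} ∈ u.1 → {m | z.coord m ≤ y.coord m} ∈ u.1 →
        z.limPt u ∈ S) ∧
    K = closure S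

end StandardSequence

/-! Only the closed sets and connectedness of `MMStar` are used about `Ψ`. Choose selectors y < x <
z. The remainder of ⋃ [y_m, z_m] is disjoint from that of the complement of ⋃ (a_m, b_m), so the
images of the two under `Ψ` can be separated by a closed `Z` inside an open `V` in `MM`. Interpolate
a union of disjoint closed intervals, finitely many in each fibre, and keep only those that meet two
closed sets, one catching the points Ψ(y_u), the other the points Ψ(z_u). This is the standard
sequence `C` (`exists_standardSequence_image`).

The preimage under `Ψ` of a continuum of `C` is connected, so it lies in one continuum of `A`
(`exists_subset_continuumAt`). It reaches both sides of the cut-point x_u there, hence contains it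
(`limPt_mem_of_isPreconnected`). So each continuum of `C` contains exactly one Ψ(x_u), which makes h
a bijection; continuity comes from the closed sets `starSet (C.part s)`.

The subinterval claim needs only that a closed connected set T containing x_u is the closure of its
standard cut-points. If p ∈ T were outside that closure, a function separating the two would yield a
cut-point between x_u and p, hence in T, at which the function does not vanish
(`exists_limPt_between_left`, `exists_limPt_between_right`). -/

/-! ### Stone–Čech compactifications and compactness of the remainders -/

/-- A compact neighbourhood stays closed in the compactification, so by density it absorbs a whole
open set there. -/
theorem isOpen_range_stoneCechUnit {X : Type*} [TopologicalSpace X] [CompletelyRegularSpace X]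
    [LocallyCompactSpace X] : IsOpen (range (stoneCechUnit : X → StoneCech X)) := by
  rw [isOpen_iff_mem_nhds]
  rintro _ ⟨x, rfl⟩
  obtain ⟨K, hK, hKx⟩ := exists_compact_mem_nhds x
  rw [(isInducing_stoneCechUnit (X := X)).nhds_eq_comap] at hKx
  obtain ⟨W, hW, hWK⟩ := hKx
  obtain ⟨O, hOW, hO, hxO⟩ := mem_nhds_iff.1 hW
  refine mem_of_superset (hO.mem_nhds hxO) ?_
  calc O ⊆ closure (O ∩ range stoneCechUnit) := denseRange_stoneCechUnit.open_subset_closure_inter hO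
    _ ⊆ closure (stoneCechUnit '' K) := by
        apply closure_mono
        rintro _ ⟨h1, y, rfl⟩
        exact ⟨y, hWK (hOW h1), rfl⟩
    _ = stoneCechUnit '' K := (hK.image continuous_stoneCechUnit).isClosed.closure_eq
    _ ⊆ range stoneCechUnit := image_subset_range _ _

theorem disjoint_closure_image_stoneCechUnit {X : Type*} [TopologicalSpace X] [NormalSpace X]
    {D E : Set X} (hD : IsClosed D) (hE : IsClosed E) (h : Disjoint D E) :
    Disjoint (closure ((stoneCechUnit : X → StoneCech X) '' D))
      (closure ((stoneCechUnit : X → StoneCech X) '' E)) := by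
  obtain ⟨f, hf0, hf1, hf⟩ := exists_continuous_zero_one_of_isClosed hD hE h
  have hg : Continuous fun x => (⟨f x, hf x⟩ : unitInterval) := by fun_prop
  have hG := continuous_stoneCechExtend hg
  have h0 : closure ((stoneCechUnit : X → StoneCech X) '' D) ⊆ stoneCechExtend hg ⁻¹' {0} := by
    refine closure_minimal ?_ (isClosed_singleton.preimage hG)
    rintro _ ⟨x, hx, rfl⟩
    simpa using Subtype.ext (hf0 hx)
  have h1 : closure ((stoneCechUnit : X → StoneCech X) '' E) ⊆ stoneCechExtend hg ⁻¹' {1} := by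
    refine closure_minimal ?_ (isClosed_singleton.preimage hG)
    rintro _ ⟨x, hx, rfl⟩
    simpa using Subtype.ext (hf1 hx)
  refine Disjoint.mono h0 h1 (Disjoint.preimage _ ?_)
  simp

/-- Cutting both sets down to a closed neighbourhood of a hypothetical bad point makes them
disjoint, which reduces to the previous lemma. -/
theorem closure_image_stoneCechUnit_inter {X : Type*} [TopologicalSpace X] [NormalSpace X]
    {D E : Set X} (hD : IsClosed D) (hE : IsClosed E) :
    closure ((stoneCechUnit : X → StoneCech X) '' D) ∩
      closure ((stoneCechUnit : X → StoneCech X) '' E) =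
      closure ((stoneCechUnit : X → StoneCech X) '' (D ∩ E)) := by
  refine subset_antisymm ?_ (subset_inter (closure_mono (image_mono inter_subset_left))
    (closure_mono (image_mono inter_subset_right)))
  rintro p ⟨hpD, hpE⟩
  by_contra hp
  obtain ⟨N, hN, hNc, hNs⟩ := exists_mem_nhds_isClosed_subset
    (isClosed_closure.isOpen_compl.mem_nhds hp)
  have hN' : IsClosed ((stoneCechUnit : X → StoneCech X) ⁻¹' N) :=
    hNc.preimage continuous_stoneCechUnit
  have key : ∀ F : Set X, p ∈ closure (stoneCechUnit '' F) →
      p ∈ closure (stoneCechUnit '' (F ∩ stoneCechUnit ⁻¹' N)) := by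
    intro F hF
    rw [image_inter_preimage]
    rw [mem_closure_iff_nhds] at hF ⊢
    intro t ht
    obtain ⟨q, ⟨hq1, hq2⟩, hq3⟩ := hF (t ∩ N) (inter_mem ht hN)
    exact ⟨q, hq1, hq3, hq2⟩
  refine disjoint_left.1 (disjoint_closure_image_stoneCechUnit (hD.inter hN') (hE.inter hN') ?_)
    (key D hpD) (key E hpE)
  rw [disjoint_left]
  rintro x ⟨h1, h2⟩ ⟨h3, -⟩
  exact hNs h2 (subset_closure ⟨x, ⟨h1, h3⟩, rfl⟩)

instance : CompactSpace MMStar :=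
  isCompact_iff_compactSpace.1 (isOpen_range_stoneCechUnit (X := MM)).isClosed_compl.isCompact

instance : CompactSpace NNStar := by
  refine isCompact_iff_compactSpace.1 (IsOpen.isClosed_compl ?_).isCompact
  have : range (pure : ℕ → Ultrafilter ℕ) = ⋃ n, {u : Ultrafilter ℕ | {n} ∈ u} := by
    ext u
    simp only [mem_range, mem_iUnion, mem_ofPred_eq]
    refine exists_congr fun n => ⟨?_, fun h => ?_⟩
    · rintro rfl; simp
    · obtain ⟨m, hm, rfl⟩ := Ultrafilter.eq_pure_of_finite_mem (finite_singleton n) h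
      rw [mem_singleton_iff.1 hm]
  rw [this]
  exact isOpen_iUnion fun n => ultrafilter_isOpen_basic _

instance : Nonempty NNStar := by
  refine ⟨⟨hyperfilter ℕ, ?_⟩⟩
  rintro ⟨n, hn⟩
  have : ({n} : Set ℕ) ∈ (hyperfilter ℕ : Ultrafilter ℕ) := by rw [← hn]; simp
  exact notMem_hyperfilter_of_finite (finite_singleton n) this

theorem NNStar.notMem_of_finite (u : NNStar) {s : Set ℕ} (hs : s.Finite) : s ∉ u.1 := fun h => by
  obtain ⟨m, -, hm⟩ := Ultrafilter.eq_pure_of_finite_mem hs h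
  exact u.2 ⟨m, hm.symm⟩

/-- The basic open sets are closed under complement, so closedness of all their preimages already
gives openness. -/
theorem NNStar.continuous_of_isClosed {X : Type*} [TopologicalSpace X] {f : X → NNStar}
    (h : ∀ s : Set ℕ, IsClosed {x | s ∈ (f x).1}) : Continuous f := by
  refine Continuous.codRestrict (f := fun x => (f x).1) ?_ fun x => (f x).2
  refine ultrafilterBasis_is_basis.continuous_iff.2 ?_
  rintro _ ⟨s, rfl⟩
  rw [← isClosed_compl_iff]
  convert h sᶜ using 1
  ext x
  simp [Ultrafilter.compl_mem_iff_notMem]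

/-! ### The operation D ↦ D* on subsets of 𝕄 -/

section starSet

theorem isClosed_starSet (D : Set MM) : IsClosed (starSet D) :=
  isClosed_closure.preimage continuous_subtype_val

theorem starSet_mono {D E : Set MM} (h : D ⊆ E) : starSet D ⊆ starSet E :=
  fun _ hp => closure_mono (image_mono h) hp

theorem starSet_union (D E : Set MM) : starSet (D ∪ E) = starSet D ∪ starSet E := by
  ext p
  simp [starSet, image_union, closure_union]

theorem starSet_inter {D E : Set MM} (hD : IsClosed D) (hE : IsClosed E) :
    starSet D ∩ starSet E = starSet (D ∩ E) := by
  ext p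
  simp [starSet, ← closure_image_stoneCechUnit_inter hD hE]

theorem starSet_univ : starSet univ = univ := by
  ext p
  simp [starSet, denseRange_stoneCechUnit.closure_range]

theorem starSet_of_isCompact {D : Set MM} (hD : IsCompact D) : starSet D = ∅ := by
  ext p
  simp only [starSet, (hD.image continuous_stoneCechUnit).isClosed.closure_eq, mem_ofPred_eq,
    mem_empty_iff_false, iff_false]
  exact fun h => p.2 (image_subset_range _ _ h)

theorem starSet_empty : starSet ∅ = ∅ := starSet_of_isCompact isCompact_empty

theorem disjoint_starSet {D E : Set MM} (hD : IsClosed D) (hE : IsClosed E) (h : Disjoint D E) :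
    Disjoint (starSet D) (starSet E) := by
  rw [disjoint_iff_inter_eq_empty, starSet_inter hD hE, h.inter_eq, starSet_empty]

/-- Disjoint closed subsets of `𝕄*` are separated by sets coming from `𝕄`. -/
theorem exists_isClosed_subset_isOpen_starSet {P Q : Set MMStar} (hP : IsClosed P)
    (hQ : IsClosed Q) (h : Disjoint P Q) :
    ∃ Z V : Set MM, IsClosed Z ∧ IsOpen V ∧ Z ⊆ V ∧ P ⊆ starSet Z ∧ Disjoint (starSet V) Q := by
  obtain ⟨g, hg0, hg1, -⟩ := exists_continuous_zero_one_of_isClosed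
    (hP.isCompact.image continuous_subtype_val).isClosed
    (hQ.isCompact.image continuous_subtype_val).isClosed
    (disjoint_image_of_injective Subtype.val_injective h)
  have hgι : Continuous fun x : MM => g (stoneCechUnit x) :=
    g.continuous.comp continuous_stoneCechUnit
  -- Any two levels strictly between 0 and 1 would do: `g` is 0 on `P` and 1 on `Q`.
  refine ⟨{x | g (stoneCechUnit x) ≤ 1 / 3}, {x | g (stoneCechUnit x) < 2 / 3},
    isClosed_le hgι continuous_const, isOpen_lt hgι continuous_const,
    fun x hx => lt_of_le_of_lt (show g (stoneCechUnit x) ≤ 1 / 3 from hx) (by norm_num), ?_, ?_⟩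
  · intro p hp
    have hO : IsOpen {q | g q < 1 / 3} := isOpen_lt g.continuous continuous_const
    have hpO : p.1 ∈ {q | g q < 1 / 3} := by
      change g p.1 < 1 / 3
      rw [hg0 (mem_image_of_mem _ hp)]
      norm_num
    refine closure_mono ?_ (denseRange_stoneCechUnit.open_subset_closure_inter hO hpO)
    rintro _ ⟨h1, x, rfl⟩
    exact ⟨x, le_of_lt (show g (stoneCechUnit x) < 1 / 3 from h1), rfl⟩
  · rw [disjoint_left]
    intro p hp hpQ
    have : p.1 ∈ {q | g q ≤ 2 / 3} := by
      refine closure_minimal ?_ (isClosed_le g.continuous continuous_const) hp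
      rintro _ ⟨x, hx, rfl⟩
      exact le_of_lt (show g (stoneCechUnit x) < 2 / 3 from hx)
    have h1 : g p.1 = 1 := hg1 (mem_image_of_mem _ hpQ)
    change g p.1 ≤ 2 / 3 at this
    linarith

end starSet

/-! ### The continua of a standard sequence -/

namespace StandardSequence

variable (A : StandardSequence)

theorem isCompact_Ivl (m : ℕ) : IsCompact (A.Ivl m) :=
  isCompact_singleton.prod isCompact_Icc

theorem disjoint_Ivl {i j : ℕ} (h : i ≠ j) : Disjoint (A.Ivl i) (A.Ivl j) :=
  A.pairwise_disjoint h

/-- The union of the intervals with index in `s`. -/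
def part (s : Set ℕ) : Set MM := ⋃ m ∈ s, A.Ivl m

variable {A}

theorem mem_part {s : Set ℕ} {p : MM} : p ∈ A.part s ↔ ∃ m ∈ s, p ∈ A.Ivl m := by
  simp [part]

theorem part_mono {s t : Set ℕ} (h : s ⊆ t) : A.part s ⊆ A.part t :=
  biUnion_subset_biUnion_left h

theorem part_union (s t : Set ℕ) : A.part (s ∪ t) = A.part s ∪ A.part t := biUnion_union _ _ _

theorem part_inter (s t : Set ℕ) : A.part s ∩ A.part t = A.part (s ∩ t) := by
  ext p
  simp only [mem_inter_iff, mem_part]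
  constructor
  · rintro ⟨⟨i, hi, hpi⟩, j, hj, hpj⟩
    obtain rfl : i = j := by
      by_contra hij
      exact disjoint_left.1 (A.disjoint_Ivl hij) hpi hpj
    exact ⟨i, ⟨hi, hj⟩, hpi⟩
  · rintro ⟨i, ⟨hi, hj⟩, hpi⟩
    exact ⟨⟨i, hi, hpi⟩, i, hj, hpi⟩

theorem part_empty : A.part ∅ = ∅ := by simp [part]

theorem isClosed_part_of_subset {J : ℕ → Set MM} (hJ : ∀ m, J m ⊆ A.Ivl m)
    (hc : ∀ m, IsClosed (J m)) (s : Set ℕ) : IsClosed (⋃ m ∈ s, J m) := by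
  rw [biUnion_eq_iUnion]
  exact ((A.locallyFinite.subset hJ).comp_injective Subtype.val_injective).isClosed_iUnion
    fun m => hc _

variable (A) in
theorem isClosed_part (s : Set ℕ) : IsClosed (A.part s) :=
  isClosed_part_of_subset (fun _ => subset_rfl) (fun m => (A.isCompact_Ivl m).isClosed) s

theorem mem_continuumAt {u : NNStar} {p : MMStar} :
    p ∈ A.continuumAt u ↔ ∀ s ∈ u.1, p ∈ starSet (A.part s) := by
  simp [continuumAt, uLimSet, starSet, part, image_iUnion₂]

variable (A) in
theorem isClosed_continuumAt (u : NNStar) : IsClosed (A.continuumAt u) := by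
  have : A.continuumAt u = ⋂ s ∈ u.1, starSet (A.part s) := by
    ext p
    simp [mem_continuumAt]
  rw [this]
  exact isClosed_biInter fun s _ => isClosed_starSet _

theorem continuumAt_subset_starSet (u : NNStar) : A.continuumAt u ⊆ starSet (A.part univ) :=
  fun _ hp => mem_continuumAt.1 hp _ univ_mem

theorem disjoint_starSet_part {s t : Set ℕ} (h : Disjoint s t) :
    Disjoint (starSet (A.part s)) (starSet (A.part t)) := by
  refine disjoint_starSet (A.isClosed_part s) (A.isClosed_part t) ?_
  rw [disjoint_iff_inter_eq_empty, part_inter, h.inter_eq, part_empty]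

theorem mem_of_mem_starSet_part {u : NNStar} {p : MMStar} (hp : p ∈ A.continuumAt u) {s : Set ℕ}
    (h : p ∈ starSet (A.part s)) : s ∈ u.1 := by
  by_contra hs
  rw [← Ultrafilter.compl_mem_iff_notMem] at hs
  exact disjoint_left.1 (disjoint_starSet_part disjoint_compl_right) h (mem_continuumAt.1 hp _ hs)

theorem eq_of_mem_continuumAt {u v : NNStar} {p : MMStar} (hu : p ∈ A.continuumAt u)
    (hv : p ∈ A.continuumAt v) : u = v := by
  refine Subtype.ext (Ultrafilter.coe_le_coe.1 fun s hs => ?_)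
  exact mem_of_mem_starSet_part hu (mem_continuumAt.1 hv s hs)

/-- The index sets whose part has `p` in its remainder form an ultrafilter, since D ↦ D* respects
unions and intersections of closed sets. It is free because a single interval is compact and has
empty remainder. -/
theorem exists_mem_continuumAt {p : MMStar} (hp : p ∈ starSet (A.part univ)) :
    ∃ u : NNStar, p ∈ A.continuumAt u := by
  let f : Filter ℕ :=
    { sets := {s | p ∈ starSet (A.part s)}
      univ_sets := hp
      sets_of_superset := fun h h' => starSet_mono (part_mono h') h
      inter_sets := fun {s t} h h' => by
        change p ∈ starSet (A.part (s ∩ t))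
        rw [← part_inter, ← starSet_inter (A.isClosed_part s) (A.isClosed_part t)]
        exact ⟨h, h'⟩ }
  have hf : ∀ s, s ∈ f ↔ p ∈ starSet (A.part s) := fun s => Iff.rfl
  let u := Ultrafilter.ofComplNotMemIff f fun s => by
    rw [hf, hf]
    constructor
    · intro h
      rw [← union_compl_self s, part_union, starSet_union] at hp
      exact hp.resolve_right h
    · exact fun h h' => disjoint_left.1 (disjoint_starSet_part disjoint_compl_right) h h'
  refine ⟨⟨u, ?_⟩, mem_continuumAt.2 fun s hs => hs⟩
  rintro ⟨n, hn⟩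
  have h1 : ({n} : Set ℕ) ∈ u := by rw [← hn]; simp
  have h2 : p ∈ starSet (A.part {n}) := h1
  rw [show A.part {n} = A.Ivl n by simp [part], starSet_of_isCompact (A.isCompact_Ivl n)] at h2
  exact h2

/-- Each index set and its complement split the remainder into two disjoint closed pieces, and a
connected set cannot meet both. -/
theorem exists_subset_continuumAt {T : Set MMStar} (hT : IsPreconnected T) (hne : T.Nonempty)
    (h : T ⊆ starSet (A.part univ)) : ∃ u : NNStar, T ⊆ A.continuumAt u := by
  obtain ⟨p, hp⟩ := hne
  obtain ⟨u, hu⟩ := exists_mem_continuumAt (h hp)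
  refine ⟨u, fun q hq => mem_continuumAt.2 fun s hs => ?_⟩
  refine (isPreconnected_iff_subset_of_disjoint_closed.1 hT _ _ (isClosed_starSet (A.part s))
    (isClosed_starSet (A.part sᶜ)) ?_ ?_).resolve_right (fun h' => ?_) hq
  · rwa [← starSet_union, ← part_union, union_compl_self]
  · rw [(disjoint_starSet_part disjoint_compl_right).inter_eq, inter_empty]
  · exact disjoint_left.1 (disjoint_starSet_part disjoint_compl_right)
      (mem_continuumAt.1 hu s hs) (h' hp)

/-- A sequence of points of the intervals has a `u`-limit in `[a_m, b_m]_u`. -/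
theorem exists_tendsto_continuumAt {r : ℕ → MM} {u : NNStar} (hr : ∀ᶠ m in u.1, r m ∈ A.Ivl m) :
    ∃ p ∈ A.continuumAt u, Tendsto (fun m => stoneCechUnit (r m)) u.1 (𝓝 p.1) := by
  have hlim := Ultrafilter.le_nhds_lim (u.1.map fun m => stoneCechUnit (r m))
  set p := (u.1.map fun m => stoneCechUnit (r m)).lim
  have hlim' : Tendsto (fun m => stoneCechUnit (r m)) u.1 (𝓝 p) := hlim
  have hmem : ∀ s ∈ u.1, p ∈ closure (stoneCechUnit '' A.part s) := fun s hs =>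
    mem_closure_of_tendsto hlim' ((hr.and hs).mono fun m hm =>
      mem_image_of_mem _ (mem_part.2 ⟨m, hm.2, hm.1⟩))
  refine ⟨⟨p, ?_⟩, mem_continuumAt.2 hmem, hlim'⟩
  rintro ⟨x, hx⟩
  obtain ⟨V, hV, hfin⟩ := A.locallyFinite x
  have h1 := hmem _ (Ultrafilter.compl_mem_iff_notMem.2 (u.notMem_of_finite hfin))
  rw [← hx, ← mem_preimage, ← (isInducing_stoneCechUnit (X := MM)).closure_eq_preimage_closure_image,
    mem_closure_iff_nhds] at h1
  obtain ⟨y, hyV, hy⟩ := h1 V hV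
  obtain ⟨m, hm, hym⟩ := mem_part.1 hy
  exact hm ⟨y, hym, hyV⟩

theorem mem_starSet_of_tendsto {u : NNStar} {r : ℕ → MM} {p : MMStar}
    (h : Tendsto (fun m => stoneCechUnit (r m)) u.1 (𝓝 p.1)) {D : Set MM}
    (hD : ∀ᶠ m in u.1, r m ∈ D) : p ∈ starSet D :=
  mem_closure_of_tendsto h (hD.mono fun _ hm => mem_image_of_mem _ hm)

namespace Selector

theorem tendsto_limPt (x : A.Selector) (u : NNStar) :
    Tendsto (fun m => stoneCechUnit (x.pt m)) u.1 (𝓝 (x.limPt u).1) :=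
  Ultrafilter.le_nhds_lim (u.1.map fun m => stoneCechUnit (x.pt m))

theorem limPt_mem_starSet (x : A.Selector) {u : NNStar} {D : Set MM}
    (hD : {m | x.pt m ∈ D} ∈ u.1) : x.limPt u ∈ starSet D :=
  mem_starSet_of_tendsto (x.tendsto_limPt u) hD

theorem limPt_mem_continuumAt (x : A.Selector) (u : NNStar) : x.limPt u ∈ A.continuumAt u :=
  mem_continuumAt.2 fun _ hs => x.limPt_mem_starSet
    (mem_of_superset hs fun m hm => mem_part.2 ⟨m, hm, x.pt_mem m⟩)

theorem coe_limPt (x : A.Selector) (u : NNStar) :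
    (x.limPt u).1 = Ultrafilter.extend (fun m => stoneCechUnit (x.pt m)) u.1 :=
  (ultrafilter_extend_eq_iff.2 (x.tendsto_limPt u)).symm

theorem continuous_limPt (x : A.Selector) : Continuous x.limPt := by
  refine Continuous.subtype_mk ?_ _
  exact ((continuous_ultrafilter_extend fun m => stoneCechUnit (x.pt m)).comp
    continuous_subtype_val).congr fun u => (x.coe_limPt u).symm

theorem limPt_injective (x : A.Selector) : Function.Injective x.limPt := fun u v h =>
  eq_of_mem_continuumAt (x.limPt_mem_continuumAt u) (h ▸ x.limPt_mem_continuumAt v)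

/-- The extension of m ↦ x_m to all ultrafilters has compact range, so every point of the closure is
a u-limit; principal ultrafilters give points of `MM`. -/
theorem starSet_range_pt (x : A.Selector) : starSet (range x.pt) = range x.limPt := by
  refine subset_antisymm (fun p hp => ?_) ?_
  · have hp' : p.1 ∈ range (Ultrafilter.extend fun m => (stoneCechUnit (x.pt m) : StoneCech MM)) := by
      refine closure_minimal ?_ (isCompact_range
        (continuous_ultrafilter_extend fun m => stoneCechUnit (x.pt m))).isClosed hp
      rintro _ ⟨_, ⟨m, rfl⟩, rfl⟩
      exact ⟨pure m, ultrafilter_extend_pure _ m⟩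
    obtain ⟨u, hu⟩ := hp'
    have huf : u ∉ range (pure : ℕ → Ultrafilter ℕ) := by
      rintro ⟨m, rfl⟩
      rw [ultrafilter_extend_pure] at hu
      exact p.2 ⟨_, hu⟩
    exact ⟨⟨u, huf⟩, Subtype.ext ((x.coe_limPt _).trans hu)⟩
  · rintro _ ⟨u, rfl⟩
    exact x.limPt_mem_starSet (univ_mem' fun m => mem_range_self m)

end Selector

variable (A) in
-- A separation would give a continuous `g` with only the values 0 and 1 on the continuum, both
-- attained. If u-many intervals contain a point with value 1/2, a u-limit of such points has value
-- 1/2. Otherwise, by the intermediate value theorem, u-many intervals lie on the same side of 1/2,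
-- and one of the two values is excluded.
theorem isPreconnected_continuumAt (u : NNStar) : IsPreconnected (A.continuumAt u) := by
  rw [isPreconnected_closed_iff]
  intro P Q hP hQ hPQ ⟨p, hp, hpP⟩ ⟨q, hq, hqQ⟩
  by_contra hne
  rw [not_nonempty_iff_eq_empty] at hne
  have hA := A.isClosed_continuumAt u
  obtain ⟨g, hg0, hg1, -⟩ := exists_continuous_zero_one_of_isClosed
    ((hA.inter hP).isCompact.image continuous_subtype_val).isClosed
    ((hA.inter hQ).isCompact.image continuous_subtype_val).isClosed
    (disjoint_image_of_injective Subtype.val_injective (by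
      rw [disjoint_left]
      rintro x ⟨h1, h2⟩ ⟨-, h3⟩
      exact notMem_empty x (hne ▸ ⟨h1, h2, h3⟩)))
  have hval : ∀ r ∈ A.continuumAt u, g r.1 = 0 ∨ g r.1 = 1 := fun r hr =>
    (hPQ hr).imp (fun h => hg0 (mem_image_of_mem _ ⟨hr, h⟩))
      fun h => hg1 (mem_image_of_mem _ ⟨hr, h⟩)
  have hp0 : g p.1 = 0 := hg0 (mem_image_of_mem _ ⟨hp, hpP⟩)
  have hq1 : g q.1 = 1 := hg1 (mem_image_of_mem _ ⟨hq, hqQ⟩)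
  have hgι : Continuous fun x : MM => g (stoneCechUnit x) :=
    g.continuous.comp continuous_stoneCechUnit
  have hbound : ∀ s ∈ u.1, ∀ (r : MMStar) (F : Set ℝ), r ∈ A.continuumAt u → IsClosed F →
      (∀ m ∈ s, ∀ x ∈ A.Ivl m, g (stoneCechUnit x) ∈ F) → g r.1 ∈ F := by
    intro s hs r F hr hF h
    refine closure_minimal ?_ (hF.preimage g.continuous) (mem_continuumAt.1 hr s hs)
    rintro _ ⟨x, hx, rfl⟩
    obtain ⟨m, hm, hxm⟩ := mem_part.1 hx
    exact h m hm x hxm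
  by_cases hE : ∀ᶠ m in u.1, ∃ x ∈ A.Ivl m, g (stoneCechUnit x) = 1 / 2
  · have hE' : ∀ m, ∃ x, (∃ x ∈ A.Ivl m, g (stoneCechUnit x) = 1 / 2) →
        x ∈ A.Ivl m ∧ g (stoneCechUnit x) = 1 / 2 := fun m => by
      by_cases h : ∃ x ∈ A.Ivl m, g (stoneCechUnit x) = 1 / 2
      · exact ⟨h.choose, fun _ => h.choose_spec⟩
      -- An arbitrary point: these indices do not affect the u-limit.
      · exact ⟨(0, 0), fun h' => absurd h' h⟩
    choose r hr using hE'
    obtain ⟨t, ht, htl⟩ := exists_tendsto_continuumAt (hE.mono fun m hm => (hr m hm).1)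
    have h1 : Tendsto (fun m => g (stoneCechUnit (r m))) u.1 (𝓝 (g t.1)) :=
      (g.continuous.tendsto _).comp htl
    have h2 : Tendsto (fun m => g (stoneCechUnit (r m))) u.1 (𝓝 (1 / 2)) :=
      tendsto_const_nhds.congr' (hE.mono fun m hm => (hr m hm).2.symm)
    have h3 := tendsto_nhds_unique h1 h2
    rcases hval t ht with h | h <;> norm_num [h] at h3
  · rw [Ultrafilter.eventually_not.symm] at hE
    have hdich : ∀ᶠ m in u.1, (∀ x ∈ A.Ivl m, g (stoneCechUnit x) ∈ Iic (1 / 2 : ℝ)) ∨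
        (∀ x ∈ A.Ivl m, g (stoneCechUnit x) ∈ Ici (1 / 2 : ℝ)) := hE.mono fun m hm => by
      by_contra! hcon
      obtain ⟨⟨x, hx, hx'⟩, y, hy, hy'⟩ := hcon
      have hconn : IsPreconnected (A.Ivl m) := isPreconnected_singleton.prod isPreconnected_Icc
      obtain ⟨z, hz, hz'⟩ := hconn.intermediate_value hy hx hgι.continuousOn
        ⟨(not_le.1 hy').le, (not_le.1 hx').le⟩
      exact hm ⟨z, hz, hz'⟩
    rcases Ultrafilter.eventually_or.1 hdich with h | h
    · have := hbound _ h q _ hq isClosed_Iic fun m hm => hm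
      rw [hq1] at this
      norm_num at this
    · have := hbound _ h p _ hp isClosed_Ici fun m hm => hm
      rw [hp0] at this
      norm_num at this

end StandardSequence

/-! ### Cut-points and subintervals -/

namespace StandardSequence

/-- The standard sequence of the subintervals `[l_m, r_m]` of `[a_m, b_m]`. -/
def shrink (A : StandardSequence) (l r : ℕ → unitInterval) (h : ∀ m, l m < r m)
    (hl : ∀ m, A.lo m ≤ l m) (hr : ∀ m, r m ≤ A.hi m) : StandardSequence where
  fibre := A.fibre
  lo := l
  hi := r
  lo_lt_hi := h
  pairwise_disjoint := fun _ _ hij => (A.pairwise_disjoint hij).mono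
    (prod_mono_right (Icc_subset_Icc (hl _) (hr _))) (prod_mono_right (Icc_subset_Icc (hl _) (hr _)))
  locallyFinite := A.locallyFinite.subset fun _ => prod_mono_right (Icc_subset_Icc (hl _) (hr _))

variable {A : StandardSequence}

namespace Selector

/-- The standard sequence of the intervals `[a_m, q_m]`. -/
def left (q : A.Selector) : StandardSequence :=
  A.shrink A.lo q.coord q.lo_lt (fun _ => le_rfl) fun m => (q.lt_hi m).le

/-- The standard sequence of the intervals `[q_m, b_m]`. -/
def right (q : A.Selector) : StandardSequence :=
  A.shrink q.coord A.hi q.lt_hi (fun m => (q.lo_lt m).le) fun _ => le_rfl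

variable (q : A.Selector)

theorem mem_left_part_iff {m : ℕ} {p : MM} (hp : p ∈ A.Ivl m) :
    p ∈ q.left.part univ ↔ p.2 ≤ q.coord m := by
  rw [mem_part]
  constructor
  · rintro ⟨i, -, hi⟩
    obtain rfl : i = m := by
      by_contra h
      exact disjoint_left.1 (A.disjoint_Ivl h) ⟨hi.1, hi.2.1, hi.2.2.trans (q.lt_hi i).le⟩ hp
    exact hi.2.2
  · exact fun h => ⟨m, mem_univ _, hp.1, hp.2.1, h⟩

theorem mem_right_part_iff {m : ℕ} {p : MM} (hp : p ∈ A.Ivl m) :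
    p ∈ q.right.part univ ↔ q.coord m ≤ p.2 := by
  rw [mem_part]
  constructor
  · rintro ⟨i, -, hi⟩
    obtain rfl : i = m := by
      by_contra h
      exact disjoint_left.1 (A.disjoint_Ivl h) ⟨hi.1, (q.lo_lt i).le.trans hi.2.1, hi.2.2⟩ hp
    exact hi.2.1
  · exact fun h => ⟨m, mem_univ _, hp.1, h, hp.2.2⟩

theorem left_part_subset : q.left.part univ ⊆ A.part univ := fun p hp => by
  obtain ⟨i, -, hi⟩ := mem_part.1 hp
  exact mem_part.2 ⟨i, mem_univ _, hi.1, hi.2.1, hi.2.2.trans (q.lt_hi i).le⟩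

theorem left_union_right : q.left.part univ ∪ q.right.part univ = A.part univ := by
  ext p
  constructor
  · rintro (hp | hp)
    · exact q.left_part_subset hp
    · obtain ⟨i, -, hi⟩ := mem_part.1 hp
      exact mem_part.2 ⟨i, mem_univ _, hi.1, (q.lo_lt i).le.trans hi.2.1, hi.2.2⟩
  · intro hp
    obtain ⟨m, -, hm⟩ := mem_part.1 hp
    exact (le_total p.2 (q.coord m)).imp (q.mem_left_part_iff hm).2 (q.mem_right_part_iff hm).2

theorem left_inter_right : q.left.part univ ∩ q.right.part univ ⊆ range q.pt := by
  rintro p ⟨hl, hr⟩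
  obtain ⟨m, -, hm⟩ := mem_part.1 (q.left_part_subset hl)
  exact ⟨m, Prod.ext hm.1.symm
    (le_antisymm ((q.mem_right_part_iff hm).1 hr) ((q.mem_left_part_iff hm).1 hl))⟩

/-- A standard cut-point cuts its continuum. -/
theorem limPt_mem_of_isPreconnected {u : NNStar} {T : Set MMStar} (hT : IsPreconnected T)
    (hTA : T ⊆ A.continuumAt u) (hl : (T ∩ starSet (q.left.part univ)).Nonempty)
    (hr : (T ∩ starSet (q.right.part univ)).Nonempty) : q.limPt u ∈ T := by
  -- `T` is covered by the remainders of the left and right halves, so it meets their intersection,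
  -- which consists of limits of `q`. Only the limit along `u` itself lies in this continuum.
  obtain ⟨p, hpT, hp⟩ := isPreconnected_closed_iff.1 hT _ _ (isClosed_starSet _)
    (isClosed_starSet _) (by
      rw [← starSet_union, left_union_right]
      exact hTA.trans (continuumAt_subset_starSet u)) hl hr
  rw [starSet_inter (isClosed_part _ _) (isClosed_part _ _)] at hp
  have hp' := starSet_mono q.left_inter_right hp
  rw [starSet_range_pt] at hp'
  obtain ⟨v, rfl⟩ := hp'
  rwa [eq_of_mem_continuumAt (q.limPt_mem_continuumAt v) (hTA hpT)] at hpT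

variable {q} in
theorem limPt_mem_left {x : A.Selector} {u : NNStar} (h : {m | x.coord m ≤ q.coord m} ∈ u.1) :
    x.limPt u ∈ starSet (q.left.part univ) :=
  x.limPt_mem_starSet (mem_of_superset h fun m hm => (q.mem_left_part_iff (x.pt_mem m)).2 hm)

variable {q} in
theorem limPt_mem_right {x : A.Selector} {u : NNStar} (h : {m | q.coord m ≤ x.coord m} ∈ u.1) :
    x.limPt u ∈ starSet (q.right.part univ) :=
  x.limPt_mem_starSet (mem_of_superset h fun m hm => (q.mem_right_part_iff (x.pt_mem m)).2 hm)

/-- A selector that meets `P` wherever this is possible. -/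
theorem exists_selector (x : A.Selector) (P : ℕ → unitInterval → Prop) :
    ∃ q : A.Selector, ∀ m, (∃ s, A.lo m < s ∧ s < A.hi m ∧ P m s) → P m (q.coord m) := by
  have h : ∀ m, ∃ s, A.lo m < s ∧ s < A.hi m ∧ ((∃ s, A.lo m < s ∧ s < A.hi m ∧ P m s) → P m s) := by
    intro m
    by_cases h : ∃ s, A.lo m < s ∧ s < A.hi m ∧ P m s
    · obtain ⟨s, h1, h2, h3⟩ := h
      exact ⟨s, h1, h2, fun _ => h3⟩
    · exact ⟨x.coord m, x.lo_lt m, x.lt_hi m, fun h' => absurd h' h⟩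
  choose c h1 h2 h3 using h
  exact ⟨⟨c, h1, h2⟩, h3⟩

end Selector

theorem mem_starSet_setOf_le {g : C(StoneCech MM, ℝ)} {p : MMStar} {a : ℝ} (h : a < g p.1) :
    p ∈ starSet {y | a ≤ g (stoneCechUnit y)} := by
  refine closure_mono ?_ (denseRange_stoneCechUnit.open_subset_closure_inter
    (isOpen_lt continuous_const g.continuous) h)
  rintro _ ⟨h1, x, rfl⟩
  exact ⟨x, le_of_lt (show a < g (stoneCechUnit x) from h1), rfl⟩

theorem le_of_mem_starSet_setOf_le {g : C(StoneCech MM, ℝ)} {p : MMStar} {a : ℝ}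
    (h : p ∈ starSet {y | a ≤ g (stoneCechUnit y)}) : a ≤ g p.1 := by
  refine closure_minimal (t := {q | a ≤ g q}) ?_ (isClosed_le continuous_const g.continuous) h
  rintro _ ⟨x, hx, rfl⟩
  exact hx

theorem isClosed_setOf_le (g : C(StoneCech MM, ℝ)) (a : ℝ) :
    IsClosed {y : MM | a ≤ g (stoneCechUnit y)} :=
  isClosed_le continuous_const (g.continuous.comp continuous_stoneCechUnit)

namespace Selector

theorem eventually_lt (x : A.Selector) {u : NNStar} {g : C(StoneCech MM, ℝ)} {a : ℝ}
    (h : g (x.limPt u).1 < a) : ∀ᶠ m in u.1, g (stoneCechUnit (x.pt m)) < a :=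
  ((g.continuous.tendsto _).comp (x.tendsto_limPt u)).eventually (gt_mem_nhds h)

/-- In u-many intervals let q_m be the first point from x_m on where `g` is at least 1/2. Everything
to the right of x_m with value at least 2/3 then lies beyond q_m, and `p` is in the remainder of
such points. -/
theorem exists_limPt_between_right (x : A.Selector) {u : NNStar} {p : MMStar}
    (hp : p ∈ A.continuumAt u) (hpx : p ∈ starSet (x.right.part univ)) {g : C(StoneCech MM, ℝ)}
    (hgx : g (x.limPt u).1 = 0) (hgp : g p.1 = 1) :
    ∃ q : A.Selector, 1 / 2 ≤ g (q.limPt u).1 ∧ x.limPt u ∈ starSet (q.left.part univ) ∧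
      p ∈ starSet (q.right.part univ) := by
  have hgc : ∀ n : ℕ, Continuous fun t : unitInterval => g (stoneCechUnit (n, t)) := fun n =>
    g.continuous.comp (continuous_stoneCechUnit.comp (by fun_prop))
  have hpg : p ∈ starSet {y | 2 / 3 ≤ g (stoneCechUnit y)} :=
    mem_starSet_setOf_le (by rw [hgp]; norm_num)
  have hpE : ∀ s ∈ u.1, p ∈ starSet
      (A.part s ∩ (x.right.part univ ∩ {y | 2 / 3 ≤ g (stoneCechUnit y)})) := fun s hs => by
    rw [← starSet_inter (A.isClosed_part s) ((isClosed_part _ _).inter (isClosed_setOf_le _ _)),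
      ← starSet_inter (isClosed_part _ _) (isClosed_setOf_le _ _)]
    exact ⟨mem_continuumAt.1 hp s hs, hpx, hpg⟩
  have hU : ∀ᶠ m in u.1, g (stoneCechUnit (x.pt m)) < 1 / 3 :=
    x.eventually_lt (by rw [hgx]; norm_num)
  have hW : ∀ᶠ m in u.1, ∃ t ∈ Icc (x.coord m) (A.hi m),
      2 / 3 ≤ g (stoneCechUnit (A.fibre m, t)) := by
    by_contra hcon
    rw [← Ultrafilter.eventually_not] at hcon
    have := hpE _ hcon
    rw [show A.part _ ∩ _ = ∅ from ?_, starSet_empty] at this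
    · exact this
    · rw [eq_empty_iff_forall_notMem]
      rintro ⟨n, t⟩ ⟨hy1, hy2, hy3⟩
      obtain ⟨m, hm, hym⟩ := mem_part.1 hy1
      obtain rfl : n = A.fibre m := hym.1
      exact hm ⟨t, ⟨(x.mem_right_part_iff hym).1 hy2, hym.2.2⟩, hy3⟩
  obtain ⟨q, hq⟩ := x.exists_selector fun m s => x.coord m ≤ s ∧
    1 / 2 ≤ g (stoneCechUnit (A.fibre m, s)) ∧
    ∀ t ∈ Icc (x.coord m) (A.hi m), 2 / 3 ≤ g (stoneCechUnit (A.fibre m, t)) → s ≤ t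
  have hq' := (hU.and hW).mono fun m ⟨hm1, t, ht, hgt⟩ => hq m (by
    have hc : IsCompact {t | t ∈ Icc (x.coord m) (A.hi m) ∧
        1 / 2 ≤ g (stoneCechUnit (A.fibre m, t))} :=
      isCompact_Icc.inter_right (isClosed_le continuous_const (hgc _))
    obtain ⟨s, ⟨hs1, hs2⟩, hs3⟩ := hc.exists_isLeast ⟨t, ht, le_trans (by norm_num) hgt⟩
    have hxs : x.coord m ≠ s := by
      rintro rfl
      exact absurd (lt_of_le_of_lt hs2 hm1) (by norm_num)
    -- The gap between 1/2 and 2/3 keeps `s` strictly below `t`, hence off the right end-point,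
    -- which `t` may equal.
    obtain ⟨r, hr1, hr2⟩ := intermediate_value_Icc ht.1 (hgc (A.fibre m)).continuousOn
      (⟨hm1.le.trans (by norm_num), le_trans (by norm_num) hgt⟩ :
        (1 / 2 : ℝ) ∈ Icc _ _)
    have hrt : r ≠ t := by
      rintro rfl
      exact absurd (hgt.trans hr2.le) (by norm_num)
    refine ⟨s, (x.lo_lt m).trans_le hs1.1, ?_, hs1.1, hs2, fun t' ht' hgt' =>
      hs3 ⟨ht', le_trans (by norm_num) hgt'⟩⟩
    exact (hs3 ⟨⟨hr1.1, hr1.2.trans ht.2⟩, hr2.ge⟩).trans_lt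
      ((lt_of_le_of_ne hr1.2 hrt).trans_le ht.2))
  refine ⟨q, le_of_mem_starSet_setOf_le (q.limPt_mem_starSet (hq'.mono fun m hm => hm.2.1)),
    limPt_mem_left (hq'.mono fun m hm => hm.1), starSet_mono ?_ (hpE _ hq')⟩
  rintro ⟨n, t⟩ ⟨hy1, hy2, hy3⟩
  obtain ⟨m, hm, hym⟩ := mem_part.1 hy1
  obtain rfl : n = A.fibre m := hym.1
  exact (q.mem_right_part_iff hym).2 (hm.2.2 t ⟨(x.mem_right_part_iff hym).1 hy2, hym.2.2⟩ hy3)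

/-- Mirror image of the preceding lemma, with the last point up to x_m where `g` is at least 1/2. -/
theorem exists_limPt_between_left (x : A.Selector) {u : NNStar} {p : MMStar}
    (hp : p ∈ A.continuumAt u) (hpx : p ∈ starSet (x.left.part univ)) {g : C(StoneCech MM, ℝ)}
    (hgx : g (x.limPt u).1 = 0) (hgp : g p.1 = 1) :
    ∃ q : A.Selector, 1 / 2 ≤ g (q.limPt u).1 ∧ x.limPt u ∈ starSet (q.right.part univ) ∧
      p ∈ starSet (q.left.part univ) := by
  have hgc : ∀ n : ℕ, Continuous fun t : unitInterval => g (stoneCechUnit (n, t)) := fun n =>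
    g.continuous.comp (continuous_stoneCechUnit.comp (by fun_prop))
  have hpg : p ∈ starSet {y | 2 / 3 ≤ g (stoneCechUnit y)} :=
    mem_starSet_setOf_le (by rw [hgp]; norm_num)
  have hpE : ∀ s ∈ u.1, p ∈ starSet
      (A.part s ∩ (x.left.part univ ∩ {y | 2 / 3 ≤ g (stoneCechUnit y)})) := fun s hs => by
    rw [← starSet_inter (A.isClosed_part s) ((isClosed_part _ _).inter (isClosed_setOf_le _ _)),
      ← starSet_inter (isClosed_part _ _) (isClosed_setOf_le _ _)]
    exact ⟨mem_continuumAt.1 hp s hs, hpx, hpg⟩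
  have hU : ∀ᶠ m in u.1, g (stoneCechUnit (x.pt m)) < 1 / 3 :=
    x.eventually_lt (by rw [hgx]; norm_num)
  have hW : ∀ᶠ m in u.1, ∃ t ∈ Icc (A.lo m) (x.coord m),
      2 / 3 ≤ g (stoneCechUnit (A.fibre m, t)) := by
    by_contra hcon
    rw [← Ultrafilter.eventually_not] at hcon
    have := hpE _ hcon
    rw [show A.part _ ∩ _ = ∅ from ?_, starSet_empty] at this
    · exact this
    · rw [eq_empty_iff_forall_notMem]
      rintro ⟨n, t⟩ ⟨hy1, hy2, hy3⟩
      obtain ⟨m, hm, hym⟩ := mem_part.1 hy1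
      obtain rfl : n = A.fibre m := hym.1
      exact hm ⟨t, ⟨hym.2.1, (x.mem_left_part_iff hym).1 hy2⟩, hy3⟩
  obtain ⟨q, hq⟩ := x.exists_selector fun m s => s ≤ x.coord m ∧
    1 / 2 ≤ g (stoneCechUnit (A.fibre m, s)) ∧
    ∀ t ∈ Icc (A.lo m) (x.coord m), 2 / 3 ≤ g (stoneCechUnit (A.fibre m, t)) → t ≤ s
  have hq' := (hU.and hW).mono fun m ⟨hm1, t, ht, hgt⟩ => hq m (by
    have hc : IsCompact {t | t ∈ Icc (A.lo m) (x.coord m) ∧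
        1 / 2 ≤ g (stoneCechUnit (A.fibre m, t))} :=
      isCompact_Icc.inter_right (isClosed_le continuous_const (hgc _))
    obtain ⟨s, ⟨hs1, hs2⟩, hs3⟩ := hc.exists_isGreatest ⟨t, ht, le_trans (by norm_num) hgt⟩
    have hxs : x.coord m ≠ s := by
      rintro rfl
      exact absurd (lt_of_le_of_lt hs2 hm1) (by norm_num)
    obtain ⟨r, hr1, hr2⟩ := intermediate_value_Icc' ht.2 (hgc (A.fibre m)).continuousOn
      (⟨hm1.le.trans (by norm_num), le_trans (by norm_num) hgt⟩ :
        (1 / 2 : ℝ) ∈ Icc _ _)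
    have hrt : t ≠ r := by
      rintro rfl
      exact absurd (hgt.trans hr2.le) (by norm_num)
    refine ⟨s, ?_, hs1.2.trans_lt (x.lt_hi m), hs1.2, hs2, fun t' ht' hgt' =>
      hs3 ⟨ht', le_trans (by norm_num) hgt'⟩⟩
    exact (ht.1.trans_lt (lt_of_le_of_ne hr1.1 hrt)).trans_le
      (hs3 ⟨⟨ht.1.trans hr1.1, hr1.2⟩, hr2.ge⟩))
  refine ⟨q, le_of_mem_starSet_setOf_le (q.limPt_mem_starSet (hq'.mono fun m hm => hm.2.1)),
    limPt_mem_right (hq'.mono fun m hm => hm.1), starSet_mono ?_ (hpE _ hq')⟩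
  rintro ⟨n, t⟩ ⟨hy1, hy2, hy3⟩
  obtain ⟨m, hm, hym⟩ := mem_part.1 hy1
  obtain rfl : n = A.fibre m := hym.1
  exact (q.mem_left_part_iff hym).2 (hm.2.2 t ⟨hym.2.1, (x.mem_left_part_iff hym).1 hy2⟩ hy3)

/-- A subcontinuum of `[a_m, b_m]_u` that contains a standard cut-point is a subinterval. -/
theorem isSubinterval_of_isPreconnected (x : A.Selector) {u : NNStar} {T : Set MMStar}
    (hTc : IsClosed T) (hT : IsPreconnected T) (hTA : T ⊆ A.continuumAt u)
    (hx : x.limPt u ∈ T) : A.IsSubinterval u T := by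
  refine ⟨T ∩ range (fun q : A.Selector => q.limPt u), inter_subset_right,
    ⟨_, hx, mem_range_self x⟩, ?_, ?_⟩
  · intro y z q hy hz hyq hqz
    exact ⟨q.limPt_mem_of_isPreconnected hT hTA ⟨_, hy.1, limPt_mem_left hyq⟩
      ⟨_, hz.1, limPt_mem_right hqz⟩, mem_range_self q⟩
  · refine subset_antisymm (fun p hp => ?_) (closure_minimal inter_subset_left hTc)
    set S := T ∩ range (fun q : A.Selector => q.limPt u) with hS
    by_contra hpS
    obtain ⟨g, hg0, hg1, -⟩ := exists_continuous_zero_one_of_isClosed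
      (isClosed_closure.isCompact.image continuous_subtype_val).isClosed
      (isClosed_singleton (x := p.1))
      (show Disjoint (Subtype.val '' closure S) {p.1} by
        rw [disjoint_singleton_right]
        rintro ⟨p', hp', h⟩
        exact hpS (Subtype.ext h ▸ hp'))
    have hS0 : ∀ q : A.Selector, q.limPt u ∈ T → g (q.limPt u).1 = 0 := fun q hq =>
      hg0 (mem_image_of_mem _ (subset_closure ⟨hq, mem_range_self q⟩))
    have hgp : g p.1 = 1 := hg1 rfl
    -- A cut-point between x_u and `p` lies in `T`, so `g` must vanish there; the two lemmas on
    -- intermediate cut-points violate this.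
    have hcontra : ∀ q : A.Selector, 1 / 2 ≤ g (q.limPt u).1 → q.limPt u ∉ T := fun q h1 h2 => by
      rw [hS0 q h2] at h1
      norm_num at h1
    have hcase := continuumAt_subset_starSet u (hTA hp)
    rw [← x.left_union_right, starSet_union] at hcase
    rcases hcase with h | h
    · obtain ⟨q, hq, hxq, hpq⟩ := x.exists_limPt_between_left (hTA hp) h (hS0 x hx) hgp
      exact hcontra q hq (q.limPt_mem_of_isPreconnected hT hTA ⟨p, hp, hpq⟩ ⟨_, hx, hxq⟩)
    · obtain ⟨q, hq, hxq, hpq⟩ := x.exists_limPt_between_right (hTA hp) h (hS0 x hx) hgp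
      exact hcontra q hq (q.limPt_mem_of_isPreconnected hT hTA ⟨_, hx, hxq⟩ ⟨p, hp, hpq⟩)

end Selector

end StandardSequence

/-! ### Interpolating unions of intervals between closed and open sets -/

/-- Between a compact and an open subset of `[0,1]` there is the union of a finite disjoint family
of non-degenerate closed intervals. -/
theorem exists_finite_disjoint_Icc {K U : Set unitInterval} (hK : IsCompact K) (hU : IsOpen U)
    (hKU : K ⊆ U) : ∃ s : Set (unitInterval × unitInterval), s.Finite ∧
      (∀ a ∈ s, a.1 < a.2) ∧ s.PairwiseDisjoint (fun a => Icc a.1 a.2) ∧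
      K ⊆ (⋃ a ∈ s, Icc a.1 a.2) ∧ (⋃ a ∈ s, Icc a.1 a.2) ⊆ U := by
  have hloc : ∀ t ∈ K, ∃ a : unitInterval × unitInterval,
      a.1 < a.2 ∧ Icc a.1 a.2 ∈ 𝓝 t ∧ Icc a.1 a.2 ⊆ U := by
    intro t ht
    obtain ⟨b, c, -, hbc, hsub⟩ := exists_Icc_mem_subset_of_mem_nhds (hU.mem_nhds (hKU ht))
    refine ⟨(b, c), ?_, hbc, hsub⟩
    -- A degenerate neighbourhood would make `t` isolated.
    by_contra hlt
    have h1 : Icc b c ⊆ {t} := fun y hy => by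
      have hcb := not_lt.1 hlt
      have := mem_of_mem_nhds hbc
      exact le_antisymm (hy.2.trans (hcb.trans this.1)) (this.2.trans (hcb.trans hy.1))
    have h2 : {t} ∈ 𝓝 t := mem_of_superset hbc h1
    have h3 : (𝓝[≠] t).NeBot := inferInstance
    rw [← mem_interior_iff_mem_nhds, interior_singleton] at h2
    exact h2
  choose! f hf1 hf2 hf3 using hloc
  obtain ⟨T, hTK, hT⟩ := hK.elim_nhds_subcover (fun t => Icc (f t).1 (f t).2) hf2
  -- The required intervals are the connected components of this finite union: compact, pairwise
  -- disjoint, and non-degenerate because each contains one of the chosen neighbourhoods.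
  set F : Set unitInterval := ⋃ t ∈ T, Icc (f t).1 (f t).2 with hF
  have hFc : IsCompact F := T.isCompact_biUnion fun _ _ => isCompact_Icc
  have hcomp : ∀ t ∈ F, connectedComponentIn F t =
      Icc (sInf (connectedComponentIn F t)) (sSup (connectedComponentIn F t)) := fun t ht => by
    refine eq_Icc_of_connected_compact (isConnected_connectedComponentIn_iff.2 ht) ?_
    refine (isClosed_of_closure_subset ?_).isCompact
    refine isPreconnected_connectedComponentIn.closure.subset_connectedComponentIn
      (subset_closure (mem_connectedComponentIn ht)) ?_
    exact closure_minimal (connectedComponentIn_subset F t) hFc.isClosed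
  have hmem : ∀ t ∈ T, ∀ y ∈ Icc (f t).1 (f t).2, y ∈ F := fun t ht y hy => mem_biUnion ht hy
  have hleft : ∀ t ∈ T, (f t).1 ∈ Icc (f t).1 (f t).2 := fun t ht =>
    left_mem_Icc.2 (hf1 t (hTK t ht)).le
  have hsub : ∀ t ∈ T, Icc (f t).1 (f t).2 ⊆ connectedComponentIn F (f t).1 := fun t ht =>
    isPreconnected_Icc.subset_connectedComponentIn (hleft t ht) (hmem t ht)
  have hcompT := fun t (ht : t ∈ T) => hcomp _ (hmem t ht _ (hleft t ht))
  let c : unitInterval → unitInterval × unitInterval := fun t =>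
    (sInf (connectedComponentIn F (f t).1), sSup (connectedComponentIn F (f t).1))
  refine ⟨c '' T, T.finite_toSet.image c, ?_, ?_, ?_, ?_⟩
  · rintro _ ⟨t, ht, rfl⟩
    have h := hsub t ht
    rw [hcompT t ht] at h
    exact (h (hleft t ht)).1.trans_lt ((hf1 t (hTK t ht)).trans_le
      (h (right_mem_Icc.2 (hf1 t (hTK t ht)).le)).2)
  · rintro _ ⟨t, ht, rfl⟩ _ ⟨t', ht', rfl⟩ hne
    change Disjoint (Icc (c t).1 (c t).2) (Icc (c t').1 (c t').2)
    rw [← hcompT t ht, ← hcompT t' ht', disjoint_left]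
    intro y hy hy'
    apply hne
    simp only [c]
    rw [connectedComponentIn_eq hy, connectedComponentIn_eq hy']
  · intro y hy
    obtain ⟨t, ht, hyt⟩ := mem_iUnion₂.1 (hT hy)
    refine mem_biUnion (mem_image_of_mem c ht) ?_
    change y ∈ Icc (sInf _) (sSup _)
    rw [← hcompT t ht]
    exact hsub t ht hyt
  · refine iUnion₂_subset ?_
    rintro _ ⟨t, ht, rfl⟩
    change Icc (sInf _) (sSup _) ⊆ U
    rw [← hcompT t ht]
    exact (connectedComponentIn_subset F _).trans
      (iUnion₂_subset fun t ht => hf3 t (hTK t ht))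

/-- Between a closed and an open subset of `𝕄` there is the union of a disjoint family
of non-degenerate closed intervals, finitely many in each fibre. -/
theorem exists_disjoint_interval {Z V : Set MM} (hZ : IsClosed Z) (hV : IsOpen V) (hZV : Z ⊆ V) :
    ∃ S : Set (ℕ × unitInterval × unitInterval), (∀ n, {i ∈ S | i.1 = n}.Finite) ∧
      (∀ i ∈ S, i.2.1 < i.2.2) ∧
      S.PairwiseDisjoint (fun i => interval i.1 i.2.1 i.2.2) ∧
      Z ⊆ (⋃ i ∈ S, interval i.1 i.2.1 i.2.2) ∧ (⋃ i ∈ S, interval i.1 i.2.1 i.2.2) ⊆ V := by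
  have hn : ∀ n : ℕ, Continuous fun t : unitInterval => ((n, t) : MM) := fun n => by fun_prop
  choose s hs1 hs2 hs3 hs4 hs5 using fun n : ℕ => exists_finite_disjoint_Icc
    (hZ.preimage (hn n)).isCompact (hV.preimage (hn n)) (preimage_mono hZV)
  refine ⟨{i | i.2 ∈ s i.1}, ?_, fun i hi => hs2 _ _ hi, ?_, ?_, ?_⟩
  · intro n
    refine ((hs1 n).image (Prod.mk n)).subset ?_
    rintro ⟨k, a⟩ ⟨h1, rfl⟩
    exact ⟨a, h1, rfl⟩
  · rintro ⟨n, a⟩ ha ⟨k, b⟩ hb hne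
    refine disjoint_left.2 ?_
    rintro ⟨j, t⟩ ⟨h1, h2⟩ ⟨h3, h4⟩
    obtain rfl : j = n := h1
    obtain rfl : j = k := h3
    exact disjoint_left.1 (hs3 j ha hb fun h => hne (congrArg (Prod.mk j) h)) h2 h4
  · rintro ⟨n, t⟩ h
    obtain ⟨a, ha, hta⟩ := mem_iUnion₂.1 (hs4 n h)
    exact mem_biUnion (x := (n, a)) ha ⟨rfl, hta⟩
  · refine iUnion₂_subset ?_
    rintro ⟨n, a⟩ ha ⟨k, t⟩ ⟨h1, h2⟩
    obtain rfl : k = n := h1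
    exact hs5 k (mem_biUnion (x := a) ha h2)

theorem locallyFinite_interval {S : Set (ℕ × unitInterval × unitInterval)}
    (hS : ∀ n, {i ∈ S | i.1 = n}.Finite) :
    LocallyFinite fun i : S => interval i.1.1 i.1.2.1 i.1.2.2 := by
  rintro ⟨n, t⟩
  refine ⟨{n} ×ˢ univ, prod_mem_nhds (by simp) univ_mem, ?_⟩
  refine Finite.of_finite_image ((hS n).subset ?_) Subtype.val_injective.injOn
  rintro _ ⟨i, ⟨⟨k, r⟩, h1, h2⟩, rfl⟩
  exact ⟨i.2, h1.1.symm.trans h2.1⟩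

theorem isClosed_biUnion_interval {S : Set (ℕ × unitInterval × unitInterval)}
    (hS : ∀ n, {i ∈ S | i.1 = n}.Finite) :
    IsClosed (⋃ i ∈ S, interval i.1 i.2.1 i.2.2) := by
  rw [biUnion_eq_iUnion]
  exact (locallyFinite_interval hS).isClosed_iUnion
    fun i => (isClosed_discrete _).prod isClosed_Icc

/-- An infinite family of intervals as in `exists_disjoint_interval` can be enumerated as a
standard sequence. -/
theorem exists_standardSequence {S : Set (ℕ × unitInterval × unitInterval)}
    (hS : ∀ n, {i ∈ S | i.1 = n}.Finite) (hlt : ∀ i ∈ S, i.2.1 < i.2.2)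
    (hd : S.PairwiseDisjoint (fun i => interval i.1 i.2.1 i.2.2)) (hinf : S.Infinite) :
    ∃ C : StandardSequence, C.part univ = (⋃ i ∈ S, interval i.1 i.2.1 i.2.2) ∧
      ∀ j, ∃ i ∈ S, C.Ivl j = interval i.1 i.2.1 i.2.2 := by
  have hcount : S.Countable := by
    refine (countable_iUnion fun n => (hS n).countable).mono fun i hi => ?_
    exact mem_iUnion.2 ⟨i.1, hi, rfl⟩
  have := hcount.to_subtype
  have := hinf.to_subtype
  obtain ⟨e⟩ : Nonempty (ℕ ≃ S) := nonempty_equiv_of_countable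
  refine ⟨⟨fun j => (e j).1.1, fun j => (e j).1.2.1, fun j => (e j).1.2.2,
    fun j => hlt _ (e j).2, fun j k hjk => hd (e j).2 (e k).2
      (Subtype.val_injective.ne (e.injective.ne hjk)),
    (locallyFinite_interval hS).comp_injective e.injective⟩, ?_, fun j => ⟨_, (e j).2, rfl⟩⟩
  rw [biUnion_eq_iUnion, StandardSequence.part, biUnion_univ]
  exact e.surjective.iUnion_comp fun i : S => interval i.1.1 i.1.2.1 i.1.2.2

/-! ### Transporting a standard sequence along Ψ -/

namespace StandardSequence

/-- The union of the interiors of the intervals. -/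
def inner (A : StandardSequence) : Set MM := ⋃ m, {A.fibre m} ×ˢ Ioo (A.lo m) (A.hi m)

variable {A : StandardSequence}

theorem mem_inner {p : MM} : p ∈ A.inner ↔ ∃ m, p.1 = A.fibre m ∧ A.lo m < p.2 ∧ p.2 < A.hi m := by
  simp [inner]

variable (A) in
theorem isOpen_inner : IsOpen A.inner :=
  isOpen_iUnion fun _ => (isOpen_discrete _).prod isOpen_Ioo

variable (A) in
theorem inner_subset_part : A.inner ⊆ A.part univ := fun _ hp => by
  obtain ⟨m, h1, h2, h3⟩ := mem_inner.1 hp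
  exact mem_part.2 ⟨m, mem_univ _, h1, h2.le, h3.le⟩

/-- The image of `D*`, with `D` inside the interiors of the intervals, is enclosed, within the
image of `⋃ [a_m, b_m]`, by sets coming from `𝕄`. -/
theorem exists_subset_image_starSet (A : StandardSequence) (Ψ : MMStar ≃ₜ MMStar) {D : Set MM}
    (hD : IsClosed D) (hDA : D ⊆ A.inner) :
    ∃ Z V : Set MM, IsClosed Z ∧ IsOpen V ∧ Z ⊆ V ∧ Ψ '' starSet D ⊆ starSet Z ∧
      starSet V ⊆ Ψ '' starSet (A.part univ) := by
  have hO : IsClosed A.innerᶜ := A.isOpen_inner.isClosed_compl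
  obtain ⟨Z, V, hZ, hV, hZV, hPZ, hVQ⟩ := exists_isClosed_subset_isOpen_starSet
    (Ψ.isClosedMap _ (isClosed_starSet D)) (Ψ.isClosedMap _ (isClosed_starSet A.innerᶜ))
    (disjoint_image_of_injective Ψ.injective (disjoint_starSet hD hO
      (disjoint_compl_right.mono_left hDA)))
  refine ⟨Z, V, hZ, hV, hZV, hPZ, fun p hp => ?_⟩
  obtain ⟨q, rfl⟩ := Ψ.surjective p
  refine mem_image_of_mem _ (starSet_mono A.inner_subset_part ?_)
  have : q ∈ starSet A.inner ∪ starSet A.innerᶜ := by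
    rw [← starSet_union, union_compl_self, starSet_univ]
    trivial
  exact this.resolve_right fun h => disjoint_left.1 hVQ hp (mem_image_of_mem _ h)

theorem Selector.isClosed_range_pt (x : A.Selector) : IsClosed (range x.pt) := by
  have := isClosed_part_of_subset (J := fun m => {x.pt m})
    (fun m => singleton_subset_iff.2 (x.pt_mem m)) (fun m => isClosed_singleton) univ
  rwa [biUnion_univ, iUnion_singleton_eq_range] at this

theorem exists_mem_continuumAt_starSet {D : Set MM} (h : ∀ m, (A.Ivl m ∩ D).Nonempty)
    (u : NNStar) : (A.continuumAt u ∩ starSet D).Nonempty := by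
  choose r hr hrD using h
  obtain ⟨p, hp, hlim⟩ := exists_tendsto_continuumAt (u := u) (Eventually.of_forall hr)
  exact ⟨p, hp, mem_starSet_of_tendsto hlim (Eventually.of_forall hrD)⟩

theorem Selector.exists_left (x : A.Selector) : ∃ y : A.Selector, ∀ m, y.coord m < x.coord m := by
  choose y h1 h2 using fun m => exists_between (x.lo_lt m)
  exact ⟨⟨y, h1, fun m => (h2 m).trans (x.lt_hi m)⟩, h2⟩

theorem Selector.exists_right (x : A.Selector) : ∃ z : A.Selector, ∀ m, x.coord m < z.coord m := by
  choose z h1 h2 using fun m => exists_between (x.lt_hi m)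
  exact ⟨⟨z, fun m => (x.lo_lt m).trans (h1 m), h2⟩, h1⟩

end StandardSequence

/-- If `T ⊆ (⋃ S)*` is connected and meets `D*`, then it is in the remainder of the union of those
members of `S` that meet `D`. -/
theorem subset_starSet_of_isPreconnected {S : Set (ℕ × unitInterval × unitInterval)}
    (hS : ∀ n, {i ∈ S | i.1 = n}.Finite)
    (hd : S.PairwiseDisjoint (fun i => interval i.1 i.2.1 i.2.2)) {T : Set MMStar}
    (hT : IsPreconnected T) (hTS : T ⊆ starSet (⋃ i ∈ S, interval i.1 i.2.1 i.2.2))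
    {D : Set MM} (hD : IsClosed D) (hTD : (T ∩ starSet D).Nonempty) :
    T ⊆ starSet (⋃ i ∈ {i ∈ S | (interval i.1 i.2.1 i.2.2 ∩ D).Nonempty},
      interval i.1 i.2.1 i.2.2) := by
  have hc : ∀ P : ℕ × unitInterval × unitInterval → Prop,
      IsClosed (⋃ i ∈ {i ∈ S | P i}, interval i.1 i.2.1 i.2.2) := fun P =>
    isClosed_biUnion_interval fun n => (hS n).subset fun i hi => ⟨hi.1.1, hi.2⟩
  have h1 := hc fun i => (interval i.1 i.2.1 i.2.2 ∩ D).Nonempty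
  have h2 := hc fun i => ¬ (interval i.1 i.2.1 i.2.2 ∩ D).Nonempty
  -- The members that meet `D` and those that miss it have disjoint remainders covering `T`; the
  -- second remainder is disjoint from that of `D`, so `T` is not inside it.
  refine (isPreconnected_iff_subset_of_disjoint_closed.1 hT _ _ (isClosed_starSet _)
    (isClosed_starSet (⋃ i ∈ {i ∈ S | ¬ (interval i.1 i.2.1 i.2.2 ∩ D).Nonempty},
      interval i.1 i.2.1 i.2.2)) ?_ ?_).resolve_right fun h => ?_
  · rw [← starSet_union, ← biUnion_union]
    refine hTS.trans (starSet_mono (biUnion_subset_biUnion_left fun i hi => ?_))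
    exact (em _).imp (And.intro hi) (And.intro hi)
  · rw [(disjoint_starSet h1 h2 ?_).inter_eq, inter_empty]
    refine disjoint_left.2 fun p hp hp' => ?_
    obtain ⟨i, hi, hpi⟩ := mem_iUnion₂.1 hp
    obtain ⟨j, hj, hpj⟩ := mem_iUnion₂.1 hp'
    have hij : i ≠ j := by
      rintro rfl
      exact hj.2 hi.2
    exact disjoint_left.1 (hd hi.1 hj.1 hij) hpi hpj
  · obtain ⟨p, hpT, hpD⟩ := hTD
    refine disjoint_left.1 (disjoint_starSet h2 hD (disjoint_left.2 fun q hq hqD => ?_)) (h hpT) hpD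
    obtain ⟨i, hi, hqi⟩ := mem_iUnion₂.1 hq
    exact hi.2 ⟨q, hqi, hqD⟩

open StandardSequence

/-- A standard sequence whose union has a remainder that contains all points `Ψ(x_u)` and is inside
the image of `(⋃ [a_m, b_m])*`, and whose continua reach to both sides of the points `Ψ(x_u)`. -/
theorem exists_standardSequence_image (Ψ : MMStar ≃ₜ MMStar) (A : StandardSequence)
    (x : A.Selector) :
    ∃ C : StandardSequence, (∀ u, Ψ (x.limPt u) ∈ starSet (C.part univ)) ∧
      starSet (C.part univ) ⊆ Ψ '' starSet (A.part univ) ∧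
      (∀ v, (C.continuumAt v ∩ Ψ '' starSet (x.left.part univ)).Nonempty) ∧
      ∀ v, (C.continuumAt v ∩ Ψ '' starSet (x.right.part univ)).Nonempty := by
  obtain ⟨y, hy⟩ := x.exists_left
  obtain ⟨z, hz⟩ := x.exists_right
  let B := A.shrink y.coord z.coord (fun m => (hy m).trans (hz m)) (fun m => (y.lo_lt m).le)
    fun m => (z.lt_hi m).le
  have hB : ∀ (q : A.Selector) (u : NNStar), (∀ m, q.pt m ∈ B.Ivl m) →
      q.limPt u ∈ B.continuumAt u := fun q u hq => mem_continuumAt.2 fun s hs =>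
    q.limPt_mem_starSet (mem_of_superset hs fun m hm => mem_part.2 ⟨m, hm, hq m⟩)
  have hxB := fun u => hB x u fun m => ⟨rfl, (hy m).le, (hz m).le⟩
  have hyB := fun u => hB y u fun m => ⟨rfl, le_rfl, ((hy m).trans (hz m)).le⟩
  have hzB := fun u => hB z u fun m => ⟨rfl, ((hy m).trans (hz m)).le, le_rfl⟩
  obtain ⟨Z, V, hZ, hV, hZV, hBZ, hVA⟩ := A.exists_subset_image_starSet Ψ (B.isClosed_part univ)
    fun p hp => by
      obtain ⟨m, -, h1, h2, h3⟩ := mem_part.1 hp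
      exact mem_inner.2 ⟨m, h1, (y.lo_lt m).trans_le h2, h3.trans_lt (z.lt_hi m)⟩
  -- `ZL` catches the images of the limits of `y`, yet its remainder stays within the image of the
  -- left halves. `ZR` does the same for `z` on the right.
  obtain ⟨ZL, VL, hZL, -, hZVL, hyZ, hVL⟩ := x.left.exists_subset_image_starSet Ψ
    y.isClosed_range_pt (by
      rintro _ ⟨m, rfl⟩
      exact mem_inner.2 ⟨m, rfl, y.lo_lt m, hy m⟩)
  obtain ⟨ZR, VR, hZR, -, hZVR, hzZ, hVR⟩ := x.right.exists_subset_image_starSet Ψ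
    z.isClosed_range_pt (by
      rintro _ ⟨m, rfl⟩
      exact mem_inner.2 ⟨m, rfl, hz m, z.lt_hi m⟩)
  obtain ⟨S, hS, hlt, hd, hZS, hSV⟩ := exists_disjoint_interval hZ hV hZV
  set S₁ := {i ∈ S | (interval i.1 i.2.1 i.2.2 ∩ ZL).Nonempty}
  set S₂ := {i ∈ S₁ | (interval i.1 i.2.1 i.2.2 ∩ ZR).Nonempty}
  have h₁ : S₁ ⊆ S := sep_subset _ _
  have h₂ : S₂ ⊆ S₁ := sep_subset _ _
  have hfin : ∀ {S' : Set (ℕ × unitInterval × unitInterval)}, S' ⊆ S →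
      ∀ n, {i ∈ S' | i.1 = n}.Finite := fun h n => (hS n).subset fun i hi => ⟨h hi.1, hi.2⟩
  -- Both prunings are harmless: the image of each continuum of `B` is connected and contains Ψ(y_u)
  -- and Ψ(z_u), so it meets the remainders of `ZL` and `ZR`.
  have hcover : ∀ u, Ψ '' B.continuumAt u ⊆ starSet (⋃ i ∈ S₂, interval i.1 i.2.1 i.2.2) := by
    intro u
    have hconn : IsPreconnected (Ψ '' B.continuumAt u) :=
      (B.isPreconnected_continuumAt u).image _ Ψ.continuous.continuousOn
    refine subset_starSet_of_isPreconnected (hfin h₁) (hd.subset h₁) hconn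
      (subset_starSet_of_isPreconnected hS hd hconn ?_ hZL ?_) hZR ?_
    · exact (image_mono (continuumAt_subset_starSet u)).trans (hBZ.trans (starSet_mono hZS))
    · refine ⟨_, mem_image_of_mem Ψ (hyB u), hyZ (mem_image_of_mem Ψ ?_)⟩
      rw [y.starSet_range_pt]
      exact mem_range_self u
    · refine ⟨_, mem_image_of_mem Ψ (hzB u), hzZ (mem_image_of_mem Ψ ?_)⟩
      rw [z.starSet_range_pt]
      exact mem_range_self u
  have hmem : ∀ u, Ψ (x.limPt u) ∈ starSet (⋃ i ∈ S₂, interval i.1 i.2.1 i.2.2) := fun u =>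
    hcover u (mem_image_of_mem Ψ (hxB u))
  -- A finite union of the intervals is compact, so its remainder could not contain any Ψ(x_u).
  have hinf : S₂.Infinite := fun hf => by
    have h := hmem (Classical.arbitrary NNStar)
    have hK : IsCompact (⋃ i ∈ S₂, interval i.1 i.2.1 i.2.2) :=
      hf.isCompact_biUnion fun i _ => isCompact_singleton.prod isCompact_Icc
    rw [starSet_of_isCompact hK] at h
    exact h
  obtain ⟨C, hC, hCi⟩ := exists_standardSequence (hfin (h₂.trans h₁))
    (fun i hi => hlt i (h₁ (h₂ hi))) (hd.subset (h₂.trans h₁)) hinf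
  refine ⟨C, fun u => hC ▸ hmem u, ?_, fun v => ?_, fun v => ?_⟩
  · rw [hC]
    exact (starSet_mono ((biUnion_subset_biUnion_left (h₂.trans h₁)).trans hSV)).trans hVA
  · refine (exists_mem_continuumAt_starSet (D := ZL) (fun m => ?_) v).mono
      (inter_subset_inter_right _ ((starSet_mono hZVL).trans hVL))
    obtain ⟨i, hi, h⟩ := hCi m
    exact h ▸ hi.1.2
  · refine (exists_mem_continuumAt_starSet (D := ZR) (fun m => ?_) v).mono
      (inter_subset_inter_right _ ((starSet_mono hZVR).trans hVR))
    obtain ⟨i, hi, h⟩ := hCi m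
    exact h ▸ hi.2

/-! ### The theorem -/

theorem mainTheorem5 (Ψ : MMStar ≃ₜ MMStar) (A : StandardSequence) (x : A.Selector) :
    ∃ (C : StandardSequence) (h : NNStar ≃ₜ NNStar),
      (∀ u : NNStar,
        Ψ (x.limPt u) ∈ C.continuumAt (h u) ∧
        ∃ K : Set MMStar, A.IsSubinterval u K ∧ C.continuumAt (h u) = Ψ '' K) ∧
      Ψ '' starSet (range x.pt) = range (fun u : NNStar => Ψ (x.limPt u)) ∧
      ∃ e : ↥(range fun u : NNStar => Ψ (x.limPt u)) ≃ₜ NNStar,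
        ∀ u : NNStar, e ⟨Ψ (x.limPt u), mem_range_self u⟩ = h u := by
  obtain ⟨C, hC, hCA, hL, hR⟩ := exists_standardSequence_image Ψ A x
  have hconn : ∀ v, IsPreconnected (Ψ ⁻¹' C.continuumAt v) := fun v =>
    (Ψ.isPreconnected_preimage).2 (C.isPreconnected_continuumAt v)
  have key : ∀ v, ∃ u, Ψ ⁻¹' C.continuumAt v ⊆ A.continuumAt u ∧
      x.limPt u ∈ Ψ ⁻¹' C.continuumAt v := by
    intro v
    obtain ⟨_, hl, l, hl', rfl⟩ := hL v
    obtain ⟨_, hr, r, hr', rfl⟩ := hR v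
    obtain ⟨u, hu⟩ := exists_subset_continuumAt (A := A) (hconn v) ⟨l, hl⟩ fun p hp => by
      obtain ⟨q, hq, hqp⟩ := hCA (continuumAt_subset_starSet v hp)
      exact Ψ.injective hqp ▸ hq
    exact ⟨u, hu, x.limPt_mem_of_isPreconnected (hconn v) hu ⟨l, hl, hl'⟩ ⟨r, hr, hr'⟩⟩
  choose h hh using fun u => exists_mem_continuumAt (hC u)
  -- The index supplied by `key` must be `u`, because x_u itself lies in the preimage and continua
  -- of `A` with different indices are disjoint.
  have hsub : ∀ u, Ψ ⁻¹' C.continuumAt (h u) ⊆ A.continuumAt u := fun u => by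
    obtain ⟨w, hw, -⟩ := key (h u)
    obtain rfl := eq_of_mem_continuumAt (x.limPt_mem_continuumAt u) (hw (hh u))
    exact hw
  have hinj : Function.Injective h := fun u w huw =>
    eq_of_mem_continuumAt (x.limPt_mem_continuumAt u)
      (hsub w (show Ψ (x.limPt u) ∈ C.continuumAt (h w) from huw ▸ hh u))
  have hsurj : Function.Surjective h := fun v => by
    obtain ⟨u, -, hu⟩ := key v
    exact ⟨u, eq_of_mem_continuumAt (hh u) hu⟩
  have hcont : Continuous fun u => Ψ (x.limPt u) := Ψ.continuous.comp x.continuous_limPt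
  have hhc : Continuous h := NNStar.continuous_of_isClosed fun s => by
    have : {u | s ∈ (h u).1} = (fun u => Ψ (x.limPt u)) ⁻¹' starSet (C.part s) :=
      Set.ext fun u => ⟨mem_continuumAt.1 (hh u) s, mem_of_mem_starSet_part (hh u)⟩
    rw [this]
    exact (isClosed_starSet _).preimage hcont
  let H : NNStar ≃ₜ NNStar :=
    -- Continuity of the inverse is automatic from a compact space to a Hausdorff one.
    Continuous.homeoOfEquivCompactToT2 (f := Equiv.ofBijective h ⟨hinj, hsurj⟩) hhc
  have hemb : IsClosedEmbedding fun u => Ψ (x.limPt u) :=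
    hcont.isClosedEmbedding (Ψ.injective.comp x.limPt_injective)
  refine ⟨C, H, fun u => ⟨hh u, Ψ ⁻¹' C.continuumAt (h u), ?_, ?_⟩, ?_, ?_⟩
  · exact x.isSubinterval_of_isPreconnected ((C.isClosed_continuumAt _).preimage Ψ.continuous)
      (hconn _) (hsub u) (hh u)
  · exact (image_preimage_eq _ Ψ.surjective).symm
  · rw [x.starSet_range_pt, ← range_comp]
    rfl
  · refine ⟨hemb.isEmbedding.toHomeomorph.symm.trans H, fun u => congrArg H ?_⟩
    exact hemb.isEmbedding.toHomeomorph.symm_apply_apply u
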